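/- Theorem. All graphs are finite; loops and multiple edges are allowed. A signed graph is a graph $G$ in which each edge has a sign, $+$ or $-$. Each edge consists of two half-edges, one at each of its ends (both at the same vertex for a loop). An orientation of $G$ directs each half-edge either towards or away from its end-vertex, so that exactly one of the two half-edges of a positive edge, and both or neither of the two half-edges of a negative edge, are directed towards their end-vertices. An integer flow $\phi$ on $G$ consists of an orientation and a value $\phi(e)\in\mathbb{Z}$ for each edge $e$ such that at each vertex the sum of the incoming values equals the sum of the outgoing values; reversing an edge $e$ and replacing $\phi(e)$ by $-\phi(e)$ expresses the same flow in terms of another orientation. An orientation is positive for $\phi$ if all values of $\phi$ in terms of it are non-negative. A circuit is balanced if it has an even number of negative edges, and unbalanced otherwise. A signed circuit is a balanced circuit or an unbalanced bicircuit, that is, the union of two disjoint unbalanced circuits with a path that meets the circuits only at its ends, one on each of them, or the union of two edge-disjoint unbalanced circuits that have exactly one vertex in common (the connecting path is then this vertex). With respect to an orientation, two half-edges at the same vertex $v$ are consistent if exactly one of them is directed to $v$. A signed circuit is consistently directed if any two of its half-edges at a common vertex are consistent, except, in a bicircuit, for the two half-edges of either circuit at the end-vertex of the connecting path on that circuit.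 The characteristic flow $\chi_C\colon E(G)\to\{0,\tfrac12,1\}$ of a signed circuit $C$ is $0$ on the edges outside $C$, $1$ on the edges of a balanced circuit and of the connecting path of a bicircuit, and $\tfrac12$ on the edges of the two circuits of a bicircuit. Let $\phi$ be an integer flow on a signed graph $G$. Then $G$ has a positive orientation for $\phi$, and for every such orientation there exist a set $\mathcal{C}$ of signed circuits of $G$, all consistently directed with respect to this orientation, and positive integers $n_C$ $(C\in\mathcal{C})$ such that, in terms of this orientation, $$\phi=\sum_{C\in\mathcal{C}} n_C\,\chi_C .$$ -/

import Mathlib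

/-- A signed graph with vertex set `V` and edge set `E`; loops and multiple edges are allowed.
Each edge `e` is divided into the two half-edges `(e, false)` and `(e, true)`, and
`G.endpt h` is the end-vertex at which the half-edge `h` sits (both half-edges of a loop sit at
the same vertex). The sign of an edge is `1` or `-1`. -/
structure SignedGraph (V E : Type*) where
  endpt : E × Bool → V
  sign : E → ℤˣ

namespace SignedGraph

variable {V E : Type*} (G : SignedGraph V E)

/-- An orientation (bidirection) of a signed graph: each half-edge is directed either towards its
end-vertex (`inward h = true`) or from its end-vertex (`inward h = false`). Of the two half-edges of
a positive edge exactly one is directed towards its end-vertex; for a negative edge either both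
are or none is. -/
structure Bidirection where
  inward : E × Bool → Bool
  compat : ∀ e, G.sign e = 1 ↔ inward (e, false) ≠ inward (e, true)

open Classical in
/-- Kirchhoff's law: with respect to the orientation `τ`, the values `φ` form a flow if at every
vertex the sum of the incoming values equals the sum of the outgoing values. -/
def IsFlow {A : Type*} [AddCommGroup A] [Fintype E] (τ : G.Bidirection) (φ : E → A) : Prop :=
  ∀ v : V, ∑ h : E × Bool with G.endpt h = v ∧ τ.inward h = true, φ h.1 =
    ∑ h : E × Bool with G.endpt h = v ∧ τ.inward h = false, φ h.1

variable {G} in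
/-- The values, in terms of the orientation `τ'`, of the flow that has the values `φ` in terms of
the orientation `τ`: the value changes its sign on the edges on which the two orientations are
opposite. -/
def reexpress (τ τ' : G.Bidirection) (φ : E → ℤ) (e : E) : ℤ :=
  if ∀ b, τ.inward (e, b) = τ'.inward (e, b) then φ e else -φ e

variable {G} in
/-- `τ'` is a positive orientation for the flow that has the values `φ` in terms of `τ`. -/
def IsPositive (τ τ' : G.Bidirection) (φ : E → ℤ) : Prop :=
  ∀ e, 0 ≤ reexpress τ τ' φ e

/-- The list `l` is a walk from `u` to `v`. An entry `(e, b)` of the list means that the edge `e`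
is traversed from the end-vertex of `(e, b)` to the end-vertex of the other half-edge `(e, !b)`. -/
def IsWalk : V → List (E × Bool) → V → Prop
  | u, [], v => u = v
  | u, h :: l, v => G.endpt h = u ∧ IsWalk (G.endpt (h.1, !h.2)) l v

/-- The set of edges of a walk. -/
def walkEdges (l : List (E × Bool)) : Set E := {e | e ∈ l.map Prod.fst}

/-- The list `l` is a path (without repeated vertices, possibly trivial) from `u` to `v`. -/
def IsPath (u : V) (l : List (E × Bool)) (v : V) : Prop :=
  G.IsWalk u l v ∧ (l.map G.endpt ++ [v]).Nodup

/-- `D` is the edge set of a circuit: a closed walk of length at least one without repeated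
vertices or edges. A loop is a circuit of length one. -/
def IsCircuit (D : Set E) : Prop :=
  ∃ (u : V) (l : List (E × Bool)), l ≠ [] ∧ G.IsWalk u l u ∧ (l.map G.endpt).Nodup ∧
    (l.map Prod.fst).Nodup ∧ D = walkEdges l

/-- The set of vertices incident with an edge of `D`. -/
def vertices (D : Set E) : Set V := {v | ∃ h : E × Bool, h.1 ∈ D ∧ G.endpt h = v}

/-- A circuit with an even number of negative edges. -/
def IsBalancedCircuit (D : Set E) : Prop :=
  G.IsCircuit D ∧ Even {e ∈ D | G.sign e = -1}.ncard

/-- A circuit with an odd number of negative edges. -/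
def IsUnbalancedCircuit (D : Set E) : Prop :=
  G.IsCircuit D ∧ ¬ Even {e ∈ D | G.sign e = -1}.ncard

/-- The unbalanced circuits with edge sets `D₁` and `D₂` and the connecting path with edge set `P`
from `u₁` to `u₂` form an unbalanced bicircuit: either the circuits are disjoint, and the path meets
them only at its ends, `D₁` at `u₁` and `D₂` at `u₂`; or they have a single vertex `u₁ = u₂` and no
edge in common, and the path is trivial. -/
def IsBicircuit (D₁ D₂ P : Set E) (u₁ u₂ : V) : Prop :=
  G.IsUnbalancedCircuit D₁ ∧ G.IsUnbalancedCircuit D₂ ∧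
    ((Disjoint (G.vertices D₁) (G.vertices D₂) ∧
        ∃ l : List (E × Bool), G.IsPath u₁ l u₂ ∧ P = walkEdges l ∧
          ∀ x ∈ l.map G.endpt ++ [u₂],
            (x ∈ G.vertices D₁ ↔ x = u₁) ∧ (x ∈ G.vertices D₂ ↔ x = u₂)) ∨
      (Disjoint D₁ D₂ ∧ G.vertices D₁ ∩ G.vertices D₂ = {u₁} ∧ u₁ = u₂ ∧ P = ∅))

/-- A signed circuit (given by its edge set): a balanced circuit or an unbalanced bicircuit. -/
def IsSignedCircuit (C : Set E) : Prop :=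
  G.IsBalancedCircuit C ∨
    ∃ D₁ D₂ P u₁ u₂, G.IsBicircuit D₁ D₂ P u₁ u₂ ∧ C = D₁ ∪ P ∪ D₂

/-- The signed circuit with edge set `C` is consistently directed with respect to `τ`. Two distinct
half-edges at a common vertex are consistent if exactly one of them is directed to that vertex. In a
balanced circuit all such pairs are consistent; in an unbalanced bicircuit all pairs are, except for
the two half-edges of either circuit at the end-vertex of the connecting path on that circuit. -/
def IsConsistentlyDirected (τ : G.Bidirection) (C : Set E) : Prop :=
  (G.IsBalancedCircuit C ∧
    ∀ h k : E × Bool, h.1 ∈ C → k.1 ∈ C → h ≠ k → G.endpt h = G.endpt k →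
      τ.inward h ≠ τ.inward k) ∨
  ∃ D₁ D₂ P u₁ u₂, G.IsBicircuit D₁ D₂ P u₁ u₂ ∧ C = D₁ ∪ P ∪ D₂ ∧
    ∀ h k : E × Bool, h.1 ∈ C → k.1 ∈ C → h ≠ k → G.endpt h = G.endpt k →
      ¬ (h.1 ∈ D₁ ∧ k.1 ∈ D₁ ∧ G.endpt h = u₁) →
      ¬ (h.1 ∈ D₂ ∧ k.1 ∈ D₂ ∧ G.endpt h = u₂) →
      τ.inward h ≠ τ.inward k

open Classical in
/-- The characteristic flow of the signed circuit with edge set `C`: it is `0` outside `C`, it is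
`1/2` on the two circuits of an unbalanced bicircuit, and it is `1` on the connecting path of a
bicircuit and on a balanced circuit. -/
noncomputable def charFlow (C : Set E) (e : E) : ℚ :=
  if e ∉ C then 0
  else if G.IsBalancedCircuit C then 1
  else if ∃ D₁ D₂ P u₁ u₂, G.IsBicircuit D₁ D₂ P u₁ u₂ ∧ C = D₁ ∪ P ∪ D₂ ∧ e ∈ D₁ ∪ D₂ then 1 / 2
  else 1

end SignedGraph

/-!
A walk is called consistent if it leaves each of its inner vertices through a half-edge that is
consistent with the one through which it arrived. Consistent walks are the directed walks of an
auxiliary digraph: its vertices are the states `(v, s)`, and each half-edge `h` is an arc from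
`τ.src h`, the state that allows leaving through `h`, to `τ.tgt h`, the state after traversing the
edge of `h`. Traversing a positive edge keeps the second component of the state, traversing a
negative edge changes it. The reverse of a consistent walk is consistent, with `(v, s)` replaced by
`flip (v, s) = (v, !s)`.

In terms of a positive orientation the flow is non-negative. By Kirchhoff's law, a consistent walk
that does not use an edge more often than the flow value allows can be continued until it returns to
its initial state (`exists_walk_of_excess`). Hence a non-negative integer flow is the sum of
the edge multiplicities of closed consistent walks, and it suffices to write the edge multiplicities
of one closed consistent walk `W` as a sum of characteristic flows (`Bidirection.Walk.edgeCount_mem`).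

If the edges of `W` can be distributed over two shorter closed consistent walks, this follows by
induction. Otherwise `W` is irreducible. If it has no repeated vertex, it is a balanced circuit.
If it has one, it first closes a circuit that starts in a state `k` and ends in `flip k`; this circuit
is unbalanced. Irreducibility forces any such circuit to meet the rest of `W` in a single vertex
(`Bidirection.Irreducible.eq_of_common`): otherwise recombining segments of `W` would give two closed
walks. Therefore `W` runs cyclically through unbalanced circuits `l₁, …, lₙ` and paths joining each
`lᵢ` to the next one, and each path forms a bicircuit together with the two circuits it joins. In the
sum of the characteristic flows of these bicircuits each `lᵢ` receives one half from each side, and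
so this sum is the vector of edge multiplicities of `W` (`Bidirection.Irreducible.half_mem`).

The value of `charFlow` on a bicircuit refers to all ways of presenting its edge set. It is
determined by one of them because an edge set of a bicircuit is not a circuit, and because the edges
of the connecting path are bridges, which lie on no circuit (`Bidirection.Bicircuit.charFlow_eq`).
-/

namespace SignedGraph

variable {V E : Type*} {G : SignedGraph V E} {τ : G.Bidirection}

/-! ### Consistent walks -/

/-- The other half-edge of the same edge. -/
abbrev opp (h : E × Bool) : E × Bool := (h.1, !h.2)

/-- The opposite state at the same vertex. -/
abbrev flip (p : V × Bool) : V × Bool := (p.1, !p.2)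

/-- A state `(v, s)` stands for a walk that is at `v` and has to leave it through a half-edge `h`
with `inward h = s`. Leaving through `h` is possible exactly in the state `τ.src h`. -/
def Bidirection.src (τ : G.Bidirection) (h : E × Bool) : V × Bool := (G.endpt h, τ.inward h)

/-- The state of a walk that has just traversed the edge of `h`, starting through `h`: the next
half-edge has to be consistent with `opp h`. -/
def Bidirection.tgt (τ : G.Bidirection) (h : E × Bool) : V × Bool := flip (τ.src (opp h))

/-- `τ.Walk p l q`: the list `l` is a walk from the state `p` to the state `q` such that consecutive
half-edges at each of its inner vertices are consistent. -/
def Bidirection.Walk (τ : G.Bidirection) : V × Bool → List (E × Bool) → V × Bool → Prop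
  | p, [], q => p = q
  | p, h :: l, q => τ.src h = p ∧ Walk τ (τ.tgt h) l q

/-- The reverse walk. -/
def rev (l : List (E × Bool)) : List (E × Bool) := (l.map opp).reverse

theorem opp_opp (h : E × Bool) : opp (opp h) = h := by simp [opp]

theorem eq_or_eq_opp {h k : E × Bool} (e : h.1 = k.1) : h = k ∨ h = opp k := by
  obtain ⟨a, b⟩ := h
  obtain ⟨c, d⟩ := k
  simp only at e
  subst e
  cases b <;> cases d <;> simp [opp]

theorem flip_flip (p : V × Bool) : flip (flip p) = p := by simp [flip]

theorem flip_ne (p : V × Bool) : flip p ≠ p := by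
  intro h
  have := congrArg Prod.snd h
  simp at this

theorem eq_or_eq_flip {p q : V × Bool} (e : p.1 = q.1) : q = p ∨ q = flip p := by
  obtain ⟨a, b⟩ := p
  obtain ⟨c, d⟩ := q
  simp only at e
  subst e
  cases b <;> cases d <;> simp [flip]

theorem tgt_opp (h : E × Bool) : τ.tgt (opp h) = flip (τ.src h) := by
  rw [Bidirection.tgt, opp_opp]

theorem src_opp (h : E × Bool) : τ.src (opp h) = flip (τ.tgt h) := by
  simp [Bidirection.tgt, flip]

theorem walk_append {p r : V × Bool} {l l' : List (E × Bool)} :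
    τ.Walk p (l ++ l') r ↔ ∃ q, τ.Walk p l q ∧ τ.Walk q l' r := by
  induction l generalizing p with
  | nil => simp [Bidirection.Walk]
  | cons h l ih => simp [Bidirection.Walk, ih, and_assoc]

theorem Bidirection.Walk.append {p q r : V × Bool} {l l' : List (E × Bool)}
    (h : τ.Walk p l q) (h' : τ.Walk q l' r) : τ.Walk p (l ++ l') r :=
  walk_append.2 ⟨q, h, h'⟩

theorem walk_singleton (h : E × Bool) : τ.Walk (τ.src h) [h] (τ.tgt h) := ⟨rfl, rfl⟩

/-- The end of a walk is determined by its start and its list of half-edges. -/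
theorem Bidirection.Walk.end_unique {p q q' : V × Bool} {l : List (E × Bool)}
    (h : τ.Walk p l q) (h' : τ.Walk p l q') : q = q' := by
  induction l generalizing p with
  | nil => exact h.symm.trans h'
  | cons x l ih => exact ih h.2 h'.2

/-- A walk through the half-edge `h` passes through the state `τ.src h` there. -/
theorem Bidirection.Walk.split {p q : V × Bool} {A B : List (E × Bool)} {h : E × Bool}
    (w : τ.Walk p (A ++ h :: B) q) : τ.Walk p A (τ.src h) ∧ τ.Walk (τ.src h) (h :: B) q := by
  obtain ⟨r, h1, h2⟩ := walk_append.1 w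
  obtain rfl : τ.src h = r := h2.1
  exact ⟨h1, h2⟩

theorem Bidirection.Walk.rev {p q : V × Bool} {l : List (E × Bool)} (w : τ.Walk p l q) :
    τ.Walk (flip q) (rev l) (flip p) := by
  induction l generalizing p with
  | nil => obtain rfl : p = q := w; exact rfl
  | cons h l ih =>
    obtain ⟨rfl, w⟩ := w
    have h1 := ih w
    rw [← src_opp] at h1
    have h2 := h1.append (walk_singleton (τ := τ) (opp h))
    rw [tgt_opp] at h2
    simpa [SignedGraph.rev] using h2

theorem Bidirection.Walk.isWalk {p q : V × Bool} {l : List (E × Bool)} (w : τ.Walk p l q) :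
    G.IsWalk p.1 l q.1 := by
  induction l generalizing p with
  | nil => obtain rfl : p = q := w; exact rfl
  | cons h l ih => obtain ⟨rfl, w⟩ := w; exact ⟨rfl, ih w⟩

theorem Bidirection.Walk.fst_mem {p q : V × Bool} {l : List (E × Bool)} (w : τ.Walk p l q)
    (hl : l ≠ []) : p.1 ∈ l.map G.endpt := by
  cases l with
  | nil => exact absurd rfl hl
  | cons h l => obtain ⟨rfl, -⟩ := w; simp [Bidirection.src]

/-- The vertices of a walk, listed in two ways: as its start followed by the ends of its steps, and
as the starts of its steps followed by its end. -/
theorem IsWalk.vertices_eq {u v : V} {l : List (E × Bool)} (w : G.IsWalk u l v) :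
    u :: l.map (fun h => G.endpt (opp h)) = l.map G.endpt ++ [v] := by
  induction l generalizing u with
  | nil => obtain rfl : u = v := w; rfl
  | cons h l ih =>
    obtain ⟨rfl, w⟩ := w
    simp only [List.map_cons, List.cons_append, ← ih w]

theorem Bidirection.Walk.vertices_eq {p q : V × Bool} {l : List (E × Bool)} (w : τ.Walk p l q) :
    p.1 :: l.map (fun h => G.endpt (opp h)) = l.map G.endpt ++ [q.1] :=
  w.isWalk.vertices_eq

theorem IsWalk.nodup_opp_of_closed {u : V} {l : List (E × Bool)} (w : G.IsWalk u l u)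
    (hn : (l.map G.endpt).Nodup) : (l.map (fun h => G.endpt (opp h))).Nodup := by
  have h2 : (u :: l.map (fun h => G.endpt (opp h))).Perm (u :: l.map G.endpt) := by
    rw [w.vertices_eq]
    exact List.perm_append_singleton _ _
  exact (h2.cons_inv).nodup_iff.2 hn

theorem Bidirection.Walk.nodup_opp_of_closed {p q : V × Bool} {l : List (E × Bool)}
    (w : τ.Walk p l q) (e : p.1 = q.1) (hn : (l.map G.endpt).Nodup) :
    (l.map (fun h => G.endpt (opp h))).Nodup := by
  have h := w.isWalk
  rw [← e] at h
  exact h.nodup_opp_of_closed hn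

theorem Bidirection.Walk.endpt_opp_mem {p q : V × Bool} {l : List (E × Bool)} (w : τ.Walk p l q)
    {h : E × Bool} (hh : h ∈ l) : G.endpt (opp h) ∈ l.map G.endpt ++ [q.1] := by
  rw [← w.vertices_eq]
  exact List.mem_cons_of_mem _ (List.mem_map.2 ⟨h, hh, rfl⟩)

/-- Every step of a walk is either followed by another one or the last one. -/
theorem Bidirection.Walk.exists_succ {p q : V × Bool} {l : List (E × Bool)} (w : τ.Walk p l q)
    {h : E × Bool} (hh : h ∈ l) : τ.tgt h = q ∨ ∃ k ∈ l, τ.src k = τ.tgt h := by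
  induction l generalizing p with
  | nil => simp at hh
  | cons x l ih =>
    obtain ⟨rfl, w⟩ := w
    rcases List.mem_cons.1 hh with rfl | hh
    · cases l with
      | nil => exact Or.inl w
      | cons y l => exact Or.inr ⟨y, by simp, w.1⟩
    · rcases ih w hh with h1 | ⟨k, hk, h1⟩
      · exact Or.inl h1
      · exact Or.inr ⟨k, List.mem_cons_of_mem _ hk, h1⟩

/-- The second component of the state changes exactly at the negative edges. -/
theorem Bidirection.Walk.even_iff {p q : V × Bool} {l : List (E × Bool)} (w : τ.Walk p l q) :
    p.2 = q.2 ↔ Even (l.countP (fun h => G.sign h.1 = -1)) := by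
  induction l generalizing p with
  | nil => obtain rfl : p = q := w; simp
  | cons h l ih =>
    obtain ⟨rfl, w⟩ := w
    have h1 := ih w
    have h2 : G.sign h.1 = 1 ↔ (τ.tgt h).2 = (τ.src h).2 := by
      rw [τ.compat h.1]
      obtain ⟨e, b⟩ := h
      simp only [Bidirection.tgt, Bidirection.src, flip, opp]
      cases b <;> cases hf : τ.inward (e, false) <;> cases ht : τ.inward (e, true) <;>
        simp [hf, ht]
    rw [List.countP_cons]
    rcases Int.units_eq_one_or (G.sign h.1) with hs | hs
    · rw [← h2.1 hs, h1]
      simp [hs]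
    · have h3 : ¬ (τ.tgt h).2 = (τ.src h).2 := by
        rw [← h2, hs]; decide
      simp only [hs, decide_true, if_true, Nat.even_add_one, ← h1]
      generalize (τ.tgt h).2 = x at *
      generalize (τ.src h).2 = y at *
      generalize q.2 = z at *
      cases x <;> cases y <;> cases z <;> simp_all

theorem eq_of_endpt_eq {l : List (E × Bool)} {f : E × Bool → V} (hn : (l.map f).Nodup)
    {h k : E × Bool} (hh : h ∈ l) (hk : k ∈ l) (e : f h = f k) : h = k :=
  List.inj_on_of_nodup_map hn hh hk e

/-- A consistent walk cannot return through the half-edge by which it has just arrived; so it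
repeats no edge if it repeats no vertex. -/
theorem Bidirection.Walk.nodup_edges {p q : V × Bool} {l : List (E × Bool)} (w : τ.Walk p l q)
    (hn : (l.map G.endpt).Nodup) : (l.map Prod.fst).Nodup := by
  induction l generalizing p with
  | nil => simp
  | cons h l ih =>
    obtain ⟨rfl, w⟩ := w
    have hn' := hn
    rw [List.map_cons, List.nodup_cons] at hn
    rw [List.map_cons, List.nodup_cons]
    refine ⟨?_, ih w hn.2⟩
    rintro hm
    obtain ⟨g, hg, e⟩ := List.mem_map.1 hm
    rcases eq_or_eq_opp e with rfl | rfl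
    · exact hn.1 (List.mem_map.2 ⟨g, hg, rfl⟩)
    · cases l with
      | nil => simp at hg
      | cons k l =>
        have h1 : τ.src k = τ.tgt h := w.1
        have h2 : k = opp h := eq_of_endpt_eq hn.2 (by simp) hg (congrArg Prod.fst h1)
        rw [h2, src_opp] at h1
        exact flip_ne _ h1

theorem rev_map_endpt (l : List (E × Bool)) :
    (rev l).map G.endpt = (l.map (fun h => G.endpt (opp h))).reverse := by
  simp [rev, List.map_reverse, Function.comp_def]

theorem mem_rev {l : List (E × Bool)} {h : E × Bool} : h ∈ rev l ↔ opp h ∈ l := by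
  simp only [rev, List.mem_reverse, List.mem_map]
  constructor
  · rintro ⟨k, hk, rfl⟩
    rwa [opp_opp]
  · intro hk
    exact ⟨_, hk, opp_opp h⟩

theorem Bidirection.Walk.nodup_cons_opp {p q : V × Bool} {l : List (E × Bool)}
    (w : τ.Walk p l q) (hn : (l.map G.endpt ++ [q.1]).Nodup) :
    (p.1 :: l.map (fun h => G.endpt (opp h))).Nodup := by
  rwa [w.vertices_eq]

theorem Bidirection.Walk.inward_of_leaving {p q : V × Bool} {l : List (E × Bool)}
    (w : τ.Walk p l q) (hn : (l.map G.endpt).Nodup) {h : E × Bool} (hh : h ∈ l)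
    (e : G.endpt h = p.1) : τ.inward h = p.2 := by
  cases l with
  | nil => simp at hh
  | cons g l =>
    obtain ⟨rfl, -⟩ := w
    rw [eq_of_endpt_eq hn hh (List.mem_cons_self) e]
    rfl

theorem Bidirection.Walk.inward_of_arriving {p q : V × Bool} {l : List (E × Bool)}
    (w : τ.Walk p l q) (hn : (l.map (fun h => G.endpt (opp h))).Nodup) {h : E × Bool}
    (hh : opp h ∈ l) (e : G.endpt h = q.1) : τ.inward h = !q.2 :=
  w.rev.inward_of_leaving (by rw [rev_map_endpt]; exact List.nodup_reverse.2 hn) (mem_rev.2 hh) e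

theorem mem_walkEdges_iff {l : List (E × Bool)} {h : E × Bool} :
    h.1 ∈ walkEdges l ↔ h ∈ l ∨ opp h ∈ l := by
  simp only [walkEdges, Set.mem_ofPred_eq, List.mem_map]
  constructor
  · rintro ⟨k, hk, e⟩
    rcases eq_or_eq_opp e with rfl | rfl
    · exact Or.inl hk
    · exact Or.inr hk
  · rintro (hh | hh)
    · exact ⟨_, hh, rfl⟩
    · exact ⟨_, hh, rfl⟩

theorem Bidirection.Walk.endpt_mem {p q : V × Bool} {l : List (E × Bool)} (w : τ.Walk p l q)
    {h : E × Bool} (hh : h.1 ∈ walkEdges l) : G.endpt h ∈ l.map G.endpt ++ [q.1] := by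
  rcases mem_walkEdges_iff.1 hh with hh | hh
  · exact List.mem_append_left _ (List.mem_map.2 ⟨h, hh, rfl⟩)
  · have := w.endpt_opp_mem hh
    rwa [opp_opp] at this

theorem Bidirection.Walk.mem_of_closed {p q : V × Bool} {l : List (E × Bool)} (w : τ.Walk p l q)
    (e : p.1 = q.1) {h : E × Bool} (hh : h.1 ∈ walkEdges l) : G.endpt h ∈ l.map G.endpt := by
  have hl : l ≠ [] := by
    rintro rfl
    simp [walkEdges] at hh
  have h1 := w.endpt_mem hh
  rw [List.mem_append, List.mem_singleton] at h1
  rcases h1 with h1 | h1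
  · exact h1
  · rw [h1, ← e]
    exact w.fst_mem hl

theorem Bidirection.Walk.vertices_walkEdges {p q : V × Bool} {l : List (E × Bool)}
    (w : τ.Walk p l q) (e : p.1 = q.1) {v : V} :
    v ∈ G.vertices (walkEdges l) ↔ v ∈ l.map G.endpt := by
  constructor
  · rintro ⟨h, hh, rfl⟩
    exact w.mem_of_closed e hh
  · intro hv
    obtain ⟨h, hh, rfl⟩ := List.mem_map.1 hv
    exact ⟨h, mem_walkEdges_iff.2 (Or.inl hh), rfl⟩

/-- Along a walk that repeats no vertex, any two half-edges at a common vertex are consistent, with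
the possible exception of the vertex where a closed walk starts and ends. -/
theorem Bidirection.Walk.consistent {p q : V × Bool} {l : List (E × Bool)} (w : τ.Walk p l q)
    (hn : (l.map G.endpt).Nodup) (hn' : (l.map (fun h => G.endpt (opp h))).Nodup)
    {h k : E × Bool} (hh : h.1 ∈ walkEdges l) (hk : k.1 ∈ walkEdges l) (hne : h ≠ k)
    (he : G.endpt h = G.endpt k)
    (hq : G.endpt h = q.1 → G.endpt h ∈ l.map G.endpt → p = q) : τ.inward h ≠ τ.inward k := by
  have mixed : ∀ {h k : E × Bool}, h ∈ l → opp k ∈ l → G.endpt h = G.endpt k →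
      (G.endpt h = q.1 → G.endpt h ∈ l.map G.endpt → p = q) → τ.inward h ≠ τ.inward k := by
    intro h k hh hk he hq
    have h1 : ∃ y ∈ l, τ.src y = τ.tgt (opp k) := by
      rcases w.exists_succ hk with h1 | h1
      · have h2 : G.endpt h = q.1 := by
          rw [he, ← h1, tgt_opp]; rfl
        have h3 := hq h2 (List.mem_map.2 ⟨h, hh, rfl⟩)
        cases l with
        | nil => simp at hh
        | cons x l => exact ⟨x, by simp, by rw [h1, w.1, h3]⟩
      · exact h1
    obtain ⟨y, hy, h1⟩ := h1
    rw [tgt_opp] at h1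
    have h2 : y = h := eq_of_endpt_eq hn hy hh ((congrArg Prod.fst h1).trans he.symm)
    subst h2
    have h3 : τ.inward y = !τ.inward k := congrArg Prod.snd h1
    rw [h3]
    simp
  rcases mem_walkEdges_iff.1 hh with hh | hh <;> rcases mem_walkEdges_iff.1 hk with hk | hk
  · exact absurd (eq_of_endpt_eq hn hh hk he) hne
  · exact mixed hh hk he hq
  · exact (mixed hk hh he.symm (he ▸ hq)).symm
  · have h1 : opp h = opp k := eq_of_endpt_eq hn' hh hk (by simpa only [opp_opp] using he)
    exact absurd (by rw [← opp_opp h, h1, opp_opp]) hne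

/-! ### Circuits -/

theorem Bidirection.Walk.isCircuit {p q : V × Bool} {l : List (E × Bool)} (w : τ.Walk p l q)
    (e : p.1 = q.1) (hl : l ≠ []) (hn : (l.map G.endpt).Nodup) : G.IsCircuit (walkEdges l) := by
  refine ⟨p.1, l, hl, ?_, hn, w.nodup_edges hn, rfl⟩
  have := w.isWalk
  rwa [← e] at this

theorem ncard_negative {l : List (E × Bool)} (hn : (l.map Prod.fst).Nodup) :
    {e ∈ walkEdges l | G.sign e = -1}.ncard = l.countP (fun h => G.sign h.1 = -1) := by
  classical
  have h1 : {e ∈ walkEdges l | G.sign e = -1} =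
      (((l.map Prod.fst).filter (fun e => G.sign e = -1)).toFinset : Set E) := by
    ext e
    simp [walkEdges]
  rw [h1, Set.ncard_coe_finset, List.toFinset_card_of_nodup (hn.filter _),
    ← List.countP_eq_length_filter, List.countP_map]
  rfl

theorem Bidirection.Walk.isBalancedCircuit {p : V × Bool} {l : List (E × Bool)}
    (w : τ.Walk p l p) (hl : l ≠ []) (hn : (l.map G.endpt).Nodup) :
    G.IsBalancedCircuit (walkEdges l) := by
  refine ⟨w.isCircuit rfl hl hn, ?_⟩
  rw [ncard_negative (w.nodup_edges hn), ← w.even_iff]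

theorem Bidirection.Walk.ne_nil {p : V × Bool} {l : List (E × Bool)}
    (w : τ.Walk p l (flip p)) : l ≠ [] := by
  rintro rfl
  exact flip_ne p (Eq.symm w)

theorem Bidirection.Walk.isUnbalancedCircuit {p : V × Bool} {l : List (E × Bool)}
    (w : τ.Walk p l (flip p)) (hn : (l.map G.endpt).Nodup) :
    G.IsUnbalancedCircuit (walkEdges l) := by
  refine ⟨w.isCircuit rfl w.ne_nil hn, ?_⟩
  rw [ncard_negative (w.nodup_edges hn), ← w.even_iff]
  simp

/-- Both half-edges of an unbalanced circuit at the vertex where it is not consistent have the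
direction prescribed by the initial state. -/
theorem Bidirection.Walk.inward_of_unbalanced {p : V × Bool} {l : List (E × Bool)}
    (w : τ.Walk p l (flip p)) (hn : (l.map G.endpt).Nodup) {h : E × Bool}
    (hh : h.1 ∈ walkEdges l) (e : G.endpt h = p.1) : τ.inward h = p.2 := by
  rcases mem_walkEdges_iff.1 hh with hh | hh
  · exact w.inward_of_leaving hn hh e
  · have := w.inward_of_arriving (w.nodup_opp_of_closed rfl hn) hh e
    simpa using this

theorem Bidirection.Walk.inward_of_path_start {p q : V × Bool} {l : List (E × Bool)}
    (w : τ.Walk p l q) (hn : (l.map G.endpt ++ [q.1]).Nodup) {h : E × Bool}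
    (hh : h.1 ∈ walkEdges l) (e : G.endpt h = p.1) : τ.inward h = p.2 := by
  rcases mem_walkEdges_iff.1 hh with hh | hh
  · exact w.inward_of_leaving (List.nodup_append.1 hn).1 hh e
  · have := w.nodup_cons_opp hn
    rw [List.nodup_cons] at this
    exact absurd (List.mem_map.2 ⟨opp h, hh, by rw [opp_opp, e]⟩) this.1

theorem Bidirection.Walk.inward_of_path_end {p q : V × Bool} {l : List (E × Bool)}
    (w : τ.Walk p l q) (hn : (l.map G.endpt ++ [q.1]).Nodup) {h : E × Bool}
    (hh : h.1 ∈ walkEdges l) (e : G.endpt h = q.1) : τ.inward h = !q.2 := by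
  rcases mem_walkEdges_iff.1 hh with hh | hh
  · have h1 : G.endpt h ∈ l.map G.endpt := List.mem_map.2 ⟨h, hh, rfl⟩
    rw [e] at h1
    simpa using List.disjoint_of_nodup_append hn h1
  · exact w.inward_of_arriving (List.nodup_cons.1 (w.nodup_cons_opp hn)).2 hh e

/-- A walk that never crosses the boundary of `X` stays on one side of it. -/
theorem IsWalk.mem_iff_of_not_crossing {X : Set V} {u v : V} {l : List (E × Bool)}
    (w : G.IsWalk u l v) (hX : ∀ h ∈ l, (G.endpt h ∈ X ↔ G.endpt (opp h) ∈ X)) :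
    u ∈ X ↔ v ∈ X := by
  induction l generalizing u with
  | nil => obtain rfl : u = v := w; rfl
  | cons h l ih =>
    obtain ⟨rfl, w⟩ := w
    rw [hX h (by simp)]
    exact ih w (fun k hk => hX k (by simp [hk]))

theorem isWalk_append {u v : V} {l l' : List (E × Bool)} (w : G.IsWalk u (l ++ l') v) :
    ∃ x, G.IsWalk u l x ∧ G.IsWalk x l' v := by
  induction l generalizing u with
  | nil => exact ⟨u, rfl, w⟩
  | cons h l ih =>
    obtain ⟨x, h1, h2⟩ := ih w.2
    exact ⟨x, ⟨w.1, h1⟩, h2⟩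

/-- A circuit cannot contain exactly one edge of a cut. -/
theorem IsCircuit.not_single_crossing {D : Set E} (hD : G.IsCircuit D) {X : Set V} {x : E × Bool}
    (hx : x.1 ∈ D) (h1 : G.endpt x ∈ X) (h2 : G.endpt (opp x) ∉ X)
    (hX : ∀ h : E × Bool, h.1 ∈ D → h.1 ≠ x.1 → (G.endpt h ∈ X ↔ G.endpt (opp h) ∈ X)) :
    False := by
  obtain ⟨u, l, -, w, -, hn, rfl⟩ := hD
  obtain ⟨y, hy, e⟩ := List.mem_map.1 hx
  obtain ⟨A, B, rfl⟩ := List.append_of_mem hy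
  obtain ⟨z, wA, rfl, wB⟩ := isWalk_append w
  simp only [List.map_append, List.map_cons] at hn
  have hn' := List.nodup_middle.1 hn
  rw [List.nodup_cons] at hn'
  have hA := wA.mem_iff_of_not_crossing (X := X) (fun h hh => hX h
    (mem_walkEdges_iff.2 (Or.inl (by simp [hh]))) (fun e' => hn'.1 (by
      rw [e, ← e']; exact List.mem_append_left _ (List.mem_map.2 ⟨h, hh, rfl⟩))))
  have hB := wB.mem_iff_of_not_crossing (X := X) (fun h hh => hX h
    (mem_walkEdges_iff.2 (Or.inl (by simp [hh]))) (fun e' => hn'.1 (by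
      rw [e, ← e']; exact List.mem_append_right _ (List.mem_map.2 ⟨h, hh, rfl⟩))))
  change G.endpt (opp y) ∈ X ↔ u ∈ X at hB
  rw [hA] at hB
  rcases eq_or_eq_opp e with rfl | rfl
  · exact h2 (hB.2 h1)
  · rw [opp_opp] at hB
    exact h2 (hB.1 h1)

/-- A circuit has at most two half-edges at each vertex. -/
theorem IsCircuit.not_three {D : Set E} (hD : G.IsCircuit D) {x y z : E × Bool}
    (hx : x.1 ∈ D) (hy : y.1 ∈ D) (hz : z.1 ∈ D) (hxy : x ≠ y) (hxz : x ≠ z) (hyz : y ≠ z)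
    (e : G.endpt x = G.endpt y) (e' : G.endpt x = G.endpt z) : False := by
  obtain ⟨u, l, -, w, hn, -, rfl⟩ := hD
  have hn' := w.nodup_opp_of_closed hn
  have L : ∀ {x y : E × Bool}, x ∈ l → y ∈ l → G.endpt x = G.endpt y → x = y :=
    fun hx hy e => eq_of_endpt_eq hn hx hy e
  have R : ∀ {x y : E × Bool}, opp x ∈ l → opp y ∈ l → G.endpt x = G.endpt y → x = y := by
    intro x y hx hy e
    have := eq_of_endpt_eq hn' hx hy (by simpa only [opp_opp] using e)
    rw [← opp_opp x, this, opp_opp]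
  rcases mem_walkEdges_iff.1 hx with hx | hx <;> rcases mem_walkEdges_iff.1 hy with hy | hy <;>
    rcases mem_walkEdges_iff.1 hz with hz | hz
  · exact hxy (L hx hy e)
  · exact hxy (L hx hy e)
  · exact hxz (L hx hz e')
  · exact hyz (R hy hz (e.symm.trans e'))
  · exact hyz (L hy hz (e.symm.trans e'))
  · exact hxz (R hx hz e')
  · exact hxy (R hx hy e)
  · exact hxy (R hx hy e)

/-- A closed walk has two half-edges at its start. -/
theorem IsWalk.exists_two_halves {u : V} {l : List (E × Bool)}
    (w : G.IsWalk u l u) (hl : l ≠ []) (hn : (l.map Prod.fst).Nodup) :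
    ∃ x y : E × Bool, x.1 ∈ walkEdges l ∧ y.1 ∈ walkEdges l ∧ x ≠ y ∧ G.endpt x = u ∧
      G.endpt y = u := by
  have h1 := w.vertices_eq
  cases l with
  | nil => exact absurd rfl hl
  | cons x l =>
    have h2 : u ∈ (x :: l).map (fun h => G.endpt (opp h)) := by
      have := congrArg List.getLast? h1
      rw [List.getLast?_append] at this
      simp only [List.map_cons, List.getLast?_cons_cons] at this
      exact List.mem_of_getLast? (by simpa using this)
    obtain ⟨y, hy, e⟩ := List.mem_map.1 h2
    refine ⟨x, opp y, mem_walkEdges_iff.2 (Or.inl (by simp)),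
      mem_walkEdges_iff.2 (Or.inr (by rwa [opp_opp])), ?_, w.1, e⟩
    rintro rfl
    rcases List.mem_cons.1 hy with h | hy
    · simpa using congrArg Prod.snd h
    · rw [List.map_cons, List.nodup_cons] at hn
      exact hn.1 (List.mem_map.2 ⟨y, hy, rfl⟩)

/-! ### Sums of characteristic flows -/

/-- The sums, with non-negative integer coefficients, of characteristic flows of signed circuits that
are consistently directed with respect to `τ`. -/
def Bidirection.circuitCone (τ : G.Bidirection) : AddSubmonoid (E → ℚ) :=
  AddSubmonoid.closure (G.charFlow '' {C | G.IsSignedCircuit C ∧ G.IsConsistentlyDirected τ C})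

open Classical in
/-- How often the walk `l` traverses each edge, in either direction. -/
noncomputable def edgeCount (l : List (E × Bool)) (e : E) : ℚ := ((l.map Prod.fst).count e : ℚ)

theorem edgeCount_nil : edgeCount ([] : List (E × Bool)) = 0 := by
  funext e
  simp [edgeCount]

theorem edgeCount_append (l l' : List (E × Bool)) :
    edgeCount (l ++ l') = edgeCount l + edgeCount l' := by
  funext e
  simp [edgeCount]

theorem edgeCount_congr {l l' : List (E × Bool)}
    (h : (l.map Prod.fst).Perm (l'.map Prod.fst)) : edgeCount l = edgeCount l' := by
  classical
  funext e
  exact congrArg (Nat.cast (R := ℚ)) (h.count_eq e)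

open Classical in
theorem edgeCount_of_nodup {l : List (E × Bool)} (hn : (l.map Prod.fst).Nodup) (e : E) :
    edgeCount l e = if e ∈ walkEdges l then 1 else 0 := by
  by_cases he : e ∈ walkEdges l
  · rw [if_pos he, edgeCount, List.count_eq_one_of_mem hn he, Nat.cast_one]
  · rw [if_neg he, edgeCount, List.count_eq_zero_of_not_mem he, Nat.cast_zero]

/-- A closed consistent walk without repeated vertices traverses a balanced circuit. -/
theorem Bidirection.Walk.edgeCount_mem_of_nodup {p : V × Bool} {l : List (E × Bool)}
    (w : τ.Walk p l p) (hl : l ≠ []) (hn : (l.map G.endpt).Nodup) :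
    edgeCount l ∈ τ.circuitCone := by
  have hb := w.isBalancedCircuit hl hn
  have h1 : edgeCount l = G.charFlow (walkEdges l) := by
    funext e
    rw [edgeCount_of_nodup (w.nodup_edges hn), charFlow]
    by_cases he : e ∈ walkEdges l <;> simp [he, hb]
  rw [h1]
  refine AddSubmonoid.subset_closure ⟨_, ⟨Or.inl hb, Or.inl ⟨hb, ?_⟩⟩, rfl⟩
  intro h k hh hk hne he
  exact w.consistent hn (w.nodup_opp_of_closed rfl hn) hh hk hne he (fun _ _ => rfl)

/-! ### Bicircuits -/

/-- Two consistent walks around unbalanced circuits and a consistent walk along a path that leads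
from the first to the second, meeting only as prescribed for a bicircuit. The path starts at
`flip a`, since this is the state in which the first walk ends. -/
structure Bidirection.Bicircuit (τ : G.Bidirection) (a b : V × Bool)
    (l₁ p l₂ : List (E × Bool)) : Prop where
  walk_left : τ.Walk a l₁ (flip a)
  walk_path : τ.Walk (flip a) p b
  walk_right : τ.Walk b l₂ (flip b)
  nodup_left : (l₁.map G.endpt).Nodup
  nodup_path : (p.map G.endpt ++ [b.1]).Nodup
  nodup_right : (l₂.map G.endpt).Nodup
  left_right : ∀ v ∈ l₁.map G.endpt, v ∈ l₂.map G.endpt → v = a.1 ∧ v = b.1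
  left_path : ∀ v ∈ l₁.map G.endpt, v ∈ p.map G.endpt → v = a.1
  right_path : ∀ v ∈ l₂.map G.endpt, v ∈ p.map G.endpt → v = b.1

namespace Bidirection.Bicircuit

variable {a b : V × Bool} {l₁ p l₂ : List (E × Bool)}

theorem right_not_path (B : τ.Bicircuit a b l₁ p l₂) {v : V} (h : v ∈ l₂.map G.endpt) :
    v ∉ p.map G.endpt := by
  intro h'
  have := B.right_path v h h'
  rw [this] at h'
  simpa using List.disjoint_of_nodup_append B.nodup_path h'

theorem a_mem (B : τ.Bicircuit a b l₁ p l₂) : a.1 ∈ l₁.map G.endpt :=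
  B.walk_left.fst_mem B.walk_left.ne_nil

theorem b_mem (B : τ.Bicircuit a b l₁ p l₂) : b.1 ∈ l₂.map G.endpt :=
  B.walk_right.fst_mem B.walk_right.ne_nil

/-- If the circuits have a common vertex, then the connecting path is trivial. -/
theorem path_eq_nil (B : τ.Bicircuit a b l₁ p l₂) (e : a.1 = b.1) : p = [] := by
  by_contra hp
  exact B.right_not_path B.b_mem (e ▸ B.walk_path.fst_mem hp)

theorem eq_flip (B : τ.Bicircuit a b l₁ p l₂) (e : a.1 = b.1) : b = flip a := by
  have := B.walk_path
  rw [B.path_eq_nil e] at this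
  exact Eq.symm this

theorem disjoint_left_right (B : τ.Bicircuit a b l₁ p l₂) :
    Disjoint (walkEdges l₁) (walkEdges l₂) := by
  rw [Set.disjoint_left]
  intro e h1 h2
  have m1 := B.walk_left.mem_of_closed rfl (h := (e, false)) h1
  have m2 := B.walk_right.mem_of_closed rfl (h := (e, false)) h2
  obtain ⟨ha, hb⟩ := B.left_right _ m1 m2
  have i1 := B.walk_left.inward_of_unbalanced B.nodup_left (h := (e, false)) h1 ha
  have i2 := B.walk_right.inward_of_unbalanced B.nodup_right (h := (e, false)) h2 hb
  rw [i1, B.eq_flip (ha.symm.trans hb)] at i2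
  simp at i2

theorem isBicircuit (B : τ.Bicircuit a b l₁ p l₂) :
    G.IsBicircuit (walkEdges l₁) (walkEdges l₂) (walkEdges p) a.1 b.1 := by
  refine ⟨B.walk_left.isUnbalancedCircuit B.nodup_left,
    B.walk_right.isUnbalancedCircuit B.nodup_right, ?_⟩
  have v1 : ∀ {v}, v ∈ G.vertices (walkEdges l₁) ↔ v ∈ l₁.map G.endpt :=
    B.walk_left.vertices_walkEdges rfl
  have v2 : ∀ {v}, v ∈ G.vertices (walkEdges l₂) ↔ v ∈ l₂.map G.endpt :=
    B.walk_right.vertices_walkEdges rfl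
  by_cases e : a.1 = b.1
  · refine Or.inr ⟨B.disjoint_left_right, ?_, e, ?_⟩
    · ext v
      rw [Set.mem_inter_iff, v1, v2, Set.mem_singleton_iff]
      constructor
      · rintro ⟨h1, h2⟩
        exact (B.left_right v h1 h2).1
      · rintro rfl
        exact ⟨B.a_mem, e ▸ B.b_mem⟩
    · rw [B.path_eq_nil e]
      simp [walkEdges]
  · refine Or.inl ⟨?_, p, ⟨B.walk_path.isWalk, B.nodup_path⟩, rfl, ?_⟩
    · rw [Set.disjoint_left]
      intro v h1 h2
      obtain ⟨ha, hb⟩ := B.left_right v (v1.1 h1) (v2.1 h2)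
      exact e (ha.symm.trans hb)
    · intro x hx
      rw [v1, v2]
      rw [List.mem_append, List.mem_singleton] at hx
      refine ⟨⟨fun h => ?_, fun h => h ▸ B.a_mem⟩, ⟨fun h => ?_, fun h => h ▸ B.b_mem⟩⟩
      · rcases hx with hx | rfl
        · exact B.left_path x h hx
        · exact (B.left_right _ h B.b_mem).1
      · rcases hx with hx | hx
        · exact B.right_path x h hx
        · exact hx

theorem isConsistentlyDirected (B : τ.Bicircuit a b l₁ p l₂) :
    G.IsConsistentlyDirected τ (walkEdges l₁ ∪ walkEdges p ∪ walkEdges l₂) := by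
  refine Or.inr ⟨_, _, _, _, _, B.isBicircuit, rfl, ?_⟩
  -- At a common vertex, the half-edges of different parts have opposite directions.
  have lp : ∀ {h k : E × Bool}, h.1 ∈ walkEdges l₁ → k.1 ∈ walkEdges p →
      G.endpt h = G.endpt k → τ.inward h ≠ τ.inward k := by
    intro h k hh hk e
    have m1 := B.walk_left.mem_of_closed rfl hh
    have m2 := B.walk_path.endpt_mem hk
    rw [← e, List.mem_append, List.mem_singleton] at m2
    have ha : G.endpt h = a.1 := by
      rcases m2 with m2 | m2
      · exact B.left_path _ m1 m2
      · exact (B.left_right _ m1 (m2 ▸ B.b_mem)).1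
    rw [B.walk_left.inward_of_unbalanced B.nodup_left hh ha,
      B.walk_path.inward_of_path_start B.nodup_path hk (e.symm.trans ha)]
    simp
  have rp : ∀ {h k : E × Bool}, h.1 ∈ walkEdges l₂ → k.1 ∈ walkEdges p →
      G.endpt h = G.endpt k → τ.inward h ≠ τ.inward k := by
    intro h k hh hk e
    have m1 := B.walk_right.mem_of_closed rfl hh
    have m2 := B.walk_path.endpt_mem hk
    rw [← e, List.mem_append, List.mem_singleton] at m2
    have hb : G.endpt h = b.1 := by
      rcases m2 with m2 | m2
      · exact B.right_path _ m1 m2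
      · exact m2
    rw [B.walk_right.inward_of_unbalanced B.nodup_right hh hb,
      B.walk_path.inward_of_path_end B.nodup_path hk (e.symm.trans hb)]
    simp
  have lr : ∀ {h k : E × Bool}, h.1 ∈ walkEdges l₁ → k.1 ∈ walkEdges l₂ →
      G.endpt h = G.endpt k → τ.inward h ≠ τ.inward k := by
    intro h k hh hk e
    have m1 := B.walk_left.mem_of_closed rfl hh
    have m2 := B.walk_right.mem_of_closed rfl hk
    obtain ⟨ha, hb⟩ := B.left_right _ m1 (e ▸ m2)
    rw [B.walk_left.inward_of_unbalanced B.nodup_left hh ha,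
      B.walk_right.inward_of_unbalanced B.nodup_right hk (e.symm.trans hb),
      B.eq_flip (ha.symm.trans hb)]
    simp
  intro h k hh hk hne e hx1 hx2
  rcases hh with (hh | hh) | hh <;> rcases hk with (hk | hk) | hk
  · exact B.walk_left.consistent B.nodup_left (B.walk_left.nodup_opp_of_closed rfl B.nodup_left)
      hh hk hne e (fun h' => absurd ⟨hh, hk, h'⟩ hx1)
  · exact lp hh hk e
  · exact lr hh hk e
  · exact (lp hk hh e.symm).symm
  · refine B.walk_path.consistent (List.nodup_append.1 B.nodup_path).1
      (List.nodup_cons.1 (B.walk_path.nodup_cons_opp B.nodup_path)).2 hh hk hne e ?_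
    intro h1 h2
    rw [h1] at h2
    exact absurd h2 (B.right_not_path B.b_mem)
  · exact (rp hk hh e.symm).symm
  · exact (lr hk hh e.symm).symm
  · exact rp hh hk e
  · exact B.walk_right.consistent B.nodup_right
      (B.walk_right.nodup_opp_of_closed rfl B.nodup_right)
      hh hk hne e (fun h' => absurd ⟨hh, hk, h'⟩ hx2)

/-- The edges of the connecting path are bridges of the bicircuit: removing the edge of `x` separates
the part of the bicircuit before `x` from the part behind it. -/
theorem not_mem_circuit_of_mem_path (B : τ.Bicircuit a b l₁ p l₂) {D : Set E}
    (hD : G.IsCircuit D) (hsub : D ⊆ walkEdges l₁ ∪ walkEdges p ∪ walkEdges l₂) {e : E}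
    (he : e ∈ walkEdges p) : e ∉ D := by
  intro heD
  obtain ⟨x, hx, rfl⟩ := List.mem_map.1 he
  obtain ⟨p₁, p₂, rfl⟩ := List.append_of_mem hx
  have ha : a.1 ∈ (p₁ ++ [x]).map G.endpt := by
    cases p₁ with
    | nil =>
      have : G.endpt x = a.1 := congrArg Prod.fst B.walk_path.1
      simp [← this]
    | cons y p₁ =>
      have : G.endpt y = a.1 := congrArg Prod.fst B.walk_path.1
      simp [← this]
  have hab : a.1 ≠ b.1 := fun e => by simpa using B.path_eq_nil e
  obtain ⟨w₁, w₂⟩ := B.walk_path.split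
  have w₃ : τ.Walk (τ.tgt x) p₂ b := w₂.2
  have hn := B.nodup_path
  have hdis : ∀ v ∈ (p₁ ++ [x]).map G.endpt, v ∉ p₂.map G.endpt ++ [b.1] := by
    have h : ((p₁ ++ [x]).map G.endpt ++ (p₂.map G.endpt ++ [b.1])).Nodup := by
      simpa using hn
    exact fun v h1 h2 => List.disjoint_of_nodup_append h h1 h2
  let X : Set V := {v | v ∈ l₁.map G.endpt ∨ v ∈ (p₁ ++ [x]).map G.endpt}
  have hout : ∀ v ∈ p₂.map G.endpt ++ [b.1], v ∉ X := by
    rintro v hv (h | h)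
    · have hva : v = a.1 := by
        rcases List.mem_append.1 hv with h' | h'
        · exact B.left_path v h (by
            rw [List.map_append, List.map_cons]
            exact List.mem_append_right _ (List.mem_cons_of_mem _ h'))
        · rw [List.mem_singleton] at h'
          subst h'
          exact (B.left_right _ h B.b_mem).1
      exact hdis _ ha (hva ▸ hv)
    · exact hdis v h hv
  have hout' : ∀ v ∈ l₂.map G.endpt, v ∉ X := by
    rintro v hv (h | h)
    · obtain ⟨h1, h2⟩ := B.left_right v h hv
      exact hab (h1.symm.trans h2)
    · refine B.right_not_path hv ?_
      rw [List.map_append] at h ⊢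
      rcases List.mem_append.1 h with h | h
      · exact List.mem_append_left _ h
      · refine List.mem_append_right _ ?_
        rw [List.map_singleton, List.mem_singleton] at h
        simp [h]
  have side : ∀ h : E × Bool, h.1 ∈ walkEdges l₁ ∪ walkEdges p₁ → G.endpt h ∈ X := by
    rintro h (hh | hh)
    · exact Or.inl (B.walk_left.mem_of_closed rfl hh)
    · refine Or.inr ?_
      have := w₁.endpt_mem hh
      simpa [Bidirection.src] using this
  have side' : ∀ h : E × Bool, h.1 ∈ walkEdges p₂ ∪ walkEdges l₂ → G.endpt h ∉ X := by
    rintro h (hh | hh)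
    · exact hout _ (w₃.endpt_mem hh)
    · exact hout' _ (B.walk_right.mem_of_closed rfl hh)
  refine hD.not_single_crossing (X := X) (x := x) heD (Or.inr (by simp)) ?_ ?_
  · refine hout _ ?_
    rw [← w₃.vertices_eq]
    exact List.mem_cons_self
  · intro h hh hne
    have h1 : h.1 ∈ walkEdges l₁ ∪ walkEdges p₁ ∨ h.1 ∈ walkEdges p₂ ∪ walkEdges l₂ := by
      rcases hsub hh with (h' | h') | h'
      · exact Or.inl (Or.inl h')
      · have : h.1 ∈ walkEdges p₁ ∨ h.1 = x.1 ∨ h.1 ∈ walkEdges p₂ := by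
          simpa [walkEdges] using h'
        rcases this with h' | h' | h'
        · exact Or.inl (Or.inr h')
        · exact absurd h' hne
        · exact Or.inr (Or.inl h')
      · exact Or.inr (Or.inr h')
    rcases h1 with h1 | h1
    · exact iff_of_true (side h h1) (side (opp h) h1)
    · exact iff_of_false (side' h h1) (side' (opp h) h1)

theorem not_isCircuit (B : τ.Bicircuit a b l₁ p l₂) :
    ¬ G.IsCircuit (walkEdges l₁ ∪ walkEdges p ∪ walkEdges l₂) := by
  intro hC
  by_cases hp : p = []
  · subst hp
    have e : flip a = b := B.walk_path
    subst e
    obtain ⟨x, y, hx, hy, hxy, ex, ey⟩ := B.walk_left.isWalk.exists_two_halves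
      B.walk_left.ne_nil (B.walk_left.nodup_edges B.nodup_left)
    obtain ⟨z, -, hz, -, -, ez, -⟩ := B.walk_right.isWalk.exists_two_halves
      B.walk_right.ne_nil (B.walk_right.nodup_edges B.nodup_right)
    have hd := Set.disjoint_left.1 B.disjoint_left_right
    refine hC.not_three (Or.inl (Or.inl hx)) (Or.inl (Or.inl hy)) (Or.inr hz) hxy ?_ ?_
      (ex.trans ey.symm) (ex.trans ez.symm)
    · rintro rfl
      exact hd hx hz
    · rintro rfl
      exact hd hy hz
  · obtain ⟨x, p', rfl⟩ := List.exists_cons_of_ne_nil hp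
    have hx : x.1 ∈ walkEdges (x :: p') := mem_walkEdges_iff.2 (Or.inl (by simp))
    exact B.not_mem_circuit_of_mem_path hC subset_rfl hx (Or.inl (Or.inr hx))

theorem charFlow_eq (B : τ.Bicircuit a b l₁ p l₂) :
    G.charFlow (walkEdges l₁ ∪ walkEdges p ∪ walkEdges l₂) =
      (1 / 2 : ℚ) • edgeCount l₁ + edgeCount p + (1 / 2 : ℚ) • edgeCount l₂ := by
  have hb : ¬ G.IsBalancedCircuit (walkEdges l₁ ∪ walkEdges p ∪ walkEdges l₂) :=
    fun h => B.not_isCircuit h.1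
  have c1 := (B.isBicircuit).1.1
  have c2 := (B.isBicircuit).2.1.1
  have n1 := fun e (he : e ∈ walkEdges p) => B.not_mem_circuit_of_mem_path c1
    (fun _ h => Or.inl (Or.inl h)) he
  have n2 := fun e (he : e ∈ walkEdges p) => B.not_mem_circuit_of_mem_path c2
    (fun _ h => Or.inr h) he
  funext e
  simp only [Pi.add_apply, Pi.smul_apply, smul_eq_mul,
    edgeCount_of_nodup (B.walk_left.nodup_edges B.nodup_left),
    edgeCount_of_nodup (B.walk_right.nodup_edges B.nodup_right),
    edgeCount_of_nodup (B.walk_path.nodup_edges (List.nodup_append.1 B.nodup_path).1)]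
  by_cases hp : e ∈ walkEdges p
  · have h1 := n1 e hp
    have h2 := n2 e hp
    have hx : ¬ ∃ D₁ D₂ P u₁ u₂, G.IsBicircuit D₁ D₂ P u₁ u₂ ∧
        walkEdges l₁ ∪ walkEdges p ∪ walkEdges l₂ = D₁ ∪ P ∪ D₂ ∧ e ∈ D₁ ∪ D₂ := by
      rintro ⟨D₁, D₂, P, u₁, u₂, h, hC, he | he⟩
      · exact B.not_mem_circuit_of_mem_path h.1.1
          (hC ▸ fun _ h => Or.inl (Or.inl h)) hp he
      · exact B.not_mem_circuit_of_mem_path h.2.1.1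
          (hC ▸ fun _ h => Or.inr h) hp he
    have hm : e ∈ walkEdges l₁ ∪ walkEdges p ∪ walkEdges l₂ := Or.inl (Or.inr hp)
    rw [charFlow, if_neg (not_not.2 hm), if_neg hb, if_neg hx]
    simp [hp, h1, h2]
  · by_cases h12 : e ∈ walkEdges l₁ ∪ walkEdges l₂
    · have hx : ∃ D₁ D₂ P u₁ u₂, G.IsBicircuit D₁ D₂ P u₁ u₂ ∧
        walkEdges l₁ ∪ walkEdges p ∪ walkEdges l₂ = D₁ ∪ P ∪ D₂ ∧ e ∈ D₁ ∪ D₂ :=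
        ⟨_, _, _, _, _, B.isBicircuit, rfl, h12⟩
      have hm : e ∈ walkEdges l₁ ∪ walkEdges p ∪ walkEdges l₂ :=
        h12.elim (fun h => Or.inl (Or.inl h)) Or.inr
      rw [charFlow, if_neg (not_not.2 hm), if_neg hb, if_pos hx]
      rcases h12 with h | h
      · have := Set.disjoint_left.1 B.disjoint_left_right h
        simp [hp, h, this]
      · have := Set.disjoint_right.1 B.disjoint_left_right h
        simp [hp, h, this]
    · rw [Set.mem_union, not_or] at h12
      have hm : e ∉ walkEdges l₁ ∪ walkEdges p ∪ walkEdges l₂ := by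
        rintro ((h | h) | h)
        · exact h12.1 h
        · exact hp h
        · exact h12.2 h
      rw [charFlow, if_pos hm]
      simp [hp, h12.1, h12.2]

theorem mem_circuitCone (B : τ.Bicircuit a b l₁ p l₂) :
    (1 / 2 : ℚ) • edgeCount l₁ + edgeCount p + (1 / 2 : ℚ) • edgeCount l₂ ∈ τ.circuitCone := by
  rw [← B.charFlow_eq]
  exact AddSubmonoid.subset_closure ⟨_, ⟨Or.inr ⟨_, _, _, _, _, B.isBicircuit, rfl⟩,
    B.isConsistentlyDirected⟩, rfl⟩

end Bidirection.Bicircuit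

/-! ### Decomposition of closed consistent walks -/

/-- A list of half-edges is irreducible if its edges, with their multiplicities, cannot be
distributed over two non-empty closed consistent walks. -/
def Bidirection.Irreducible (τ : G.Bidirection) (W : List (E × Bool)) : Prop :=
  ∀ l l' c d, τ.Walk c l c → τ.Walk d l' d → l ≠ [] → l' ≠ [] →
    ¬ ((l ++ l').map Prod.fst).Perm (W.map Prod.fst)

open Classical in
theorem map_fst_perm_iff {l l' : List (E × Bool)} :
    (l.map Prod.fst).Perm (l'.map Prod.fst) ↔
      ∀ e, (l.map Prod.fst).count e = (l'.map Prod.fst).count e :=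
  List.perm_iff_count

theorem rev_perm (l : List (E × Bool)) : ((rev l).map Prod.fst).Perm (l.map Prod.fst) := by
  rw [rev, List.map_reverse, List.map_map]
  exact List.reverse_perm _

/-- Every walk with a repeated vertex runs along a path up to a vertex from which it goes around a
circuit. -/
theorem Bidirection.Walk.exists_first_circuit {p q : V × Bool} {W : List (E × Bool)}
    (w : τ.Walk p W q) (hn : ¬ (W.map G.endpt ++ [q.1]).Nodup) :
    ∃ X l Y m m', W = X ++ (l ++ Y) ∧ τ.Walk p X m ∧ τ.Walk m l m' ∧ τ.Walk m' Y q ∧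
      m.1 = m'.1 ∧ l ≠ [] ∧ ((X ++ l).map G.endpt).Nodup := by
  induction W using List.reverseRecOn generalizing q with
  | nil => simp at hn
  | append_singleton W h ih =>
    obtain ⟨w₀, w₁⟩ := w.split
    have wh : τ.tgt h = q := w₁.2
    by_cases hn₀ : (W.map G.endpt ++ [G.endpt h]).Nodup
    · have hn₁ : ((W ++ [h]).map G.endpt).Nodup := by simpa using hn₀
      have hq : q.1 ∈ (W ++ [h]).map G.endpt := by
        by_contra hq
        exact hn (List.nodup_middle.2 (by simpa using ⟨by simpa using hq, by simpa using hn₁⟩))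
      obtain ⟨y, hy, e⟩ := List.mem_map.1 hq
      obtain ⟨X, Z, hXZ⟩ := List.append_of_mem hy
      rw [hXZ] at w hn₁
      obtain ⟨wX, wZ⟩ := w.split
      exact ⟨X, y :: Z, [], τ.src y, q, by rw [hXZ, List.append_nil], wX, wZ, rfl, e, by simp,
        hn₁⟩
    · obtain ⟨X, l, Y, m, m', rfl, h1, h2, h3, h4, h5, h6⟩ := ih w₀ hn₀
      exact ⟨X, l, Y ++ [h], m, m', by simp, h1, h2, h3.append w₁, h4, h5, h6⟩

/-- If an irreducible closed walk consists of a closed walk `A` that starts at the vertex of `a`, and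
cannot be continued consistently from its end by itself, and of the remaining part `B`, then `A` and
`B` meet only at that vertex: from any other common vertex, recombining the four segments, after
reversing those of `B` if necessary, gives two closed walks. -/
theorem Bidirection.Irreducible.eq_of_common {W A B : List (E × Bool)} {a : V × Bool}
    (hW : τ.Irreducible W) (hp : ((A ++ B).map Prod.fst).Perm (W.map Prod.fst))
    (wA : τ.Walk a A (flip a)) (wB : τ.Walk (flip a) B a) {v : V} (hA : v ∈ A.map G.endpt)
    (hB : v ∈ B.map G.endpt) : v = a.1 := by
  obtain ⟨h, hh, rfl⟩ := List.mem_map.1 hA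
  obtain ⟨g, hg, e⟩ := List.mem_map.1 hB
  obtain ⟨A₁, A₂, rfl⟩ := List.append_of_mem hh
  obtain ⟨B₁, B₂, rfl⟩ := List.append_of_mem hg
  obtain ⟨a₁, a₂⟩ := wA.split
  obtain ⟨b₁, b₂⟩ := wB.split
  have na : h :: A₂ ≠ [] := by simp
  have nb : g :: B₂ ≠ [] := by simp
  generalize h :: A₂ = A₃ at *
  generalize g :: B₂ = B₃ at *
  have hp' := map_fst_perm_iff.1 hp
  by_contra hv
  rcases eq_or_eq_flip (p := τ.src h) (q := τ.src g) e.symm with e' | e'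
  · rw [e'] at b₁ b₂
    refine hW (A₃ ++ B₁) (B₃ ++ A₁) _ _ (a₂.append b₁) (b₂.append a₁) (by simp [na])
      (by simp [nb]) (map_fst_perm_iff.2 fun x => ?_)
    rw [← hp' x]
    simp only [List.map_append, List.count_append]
    omega
  · rw [e'] at b₁ b₂
    have r₁ := b₁.rev
    have r₃ := b₂.rev
    rw [flip_flip] at r₁ r₃
    refine hW (A₁ ++ rev B₁) (A₃ ++ rev B₃) _ _ (a₁.append (by simpa only [flip_flip] using r₁))
      (a₂.append r₃) ?_ (by simp [na]) (map_fst_perm_iff.2 fun x => ?_)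
    · intro h0
      obtain rfl : A₁ = [] := (List.append_eq_nil_iff.1 h0).1
      exact hv (congrArg Prod.fst (show a = τ.src h from a₁)).symm
    · rw [← hp' x]
      simp only [List.map_append, List.count_append, map_fst_perm_iff.1 (rev_perm _) x]
      omega

/-- Let an irreducible closed walk `W` begin with an unbalanced circuit `l₁`. If `l` is `l₁` or a
later unbalanced circuit in `W`, and `R` is the remainder of `W` behind `l`, then `R` together with
half of `l` and half of `l₁` is a sum of characteristic flows: `R` leads from `l` to the next
unbalanced circuit `l'`, thus closing a bicircuit, and the claim holds for `l'` by induction. -/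
theorem Bidirection.Irreducible.half_mem {W : List (E × Bool)} (hW : τ.Irreducible W)
    {m : V × Bool} {l₁ : List (E × Bool)} (w₁ : τ.Walk m l₁ (flip m))
    (n₁ : (l₁.map G.endpt).Nodup) {Z l R : List (E × Bool)} {k : V × Bool} (hWe : W = Z ++ (l ++ R))
    (wZ : τ.Walk m Z k) (wl : τ.Walk k l (flip k)) (wR : τ.Walk (flip k) R m)
    (nl : (l.map G.endpt).Nodup) (hZ : (Z = [] ∧ l = l₁) ∨ ∃ Z', Z = l₁ ++ Z') :
    (1 / 2 : ℚ) • edgeCount l + edgeCount R + (1 / 2 : ℚ) • edgeCount l₁ ∈ τ.circuitCone := by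
  induction hlen : R.length using Nat.strong_induction_on generalizing Z l R k with
  | _ N ih =>
  subst hWe
  -- The circuit `l` meets the remainder of `W` only at the vertex of `k`.
  have sep_l : ∀ v ∈ l.map G.endpt, v ∈ (R ++ Z).map G.endpt → v = k.1 := by
    refine fun v h1 h2 => hW.eq_of_common (map_fst_perm_iff.2 fun x => ?_) wl (wR.append wZ) h1 h2
    simp only [List.map_append, List.count_append]
    omega
  by_cases hn : (R.map G.endpt ++ [m.1]).Nodup
  · rcases hZ with ⟨rfl, rfl⟩ | ⟨Z', rfl⟩
    · -- If `l = l₁`, then `R` is a closed walk, so that its last vertex is repeated.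
      obtain rfl : m = k := wZ
      cases R with
      | nil => exact absurd wR (flip_ne m)
      | cons x R =>
        have hx : G.endpt x = m.1 := congrArg Prod.fst wR.1
        simp [hx] at hn
    · have wZ' : τ.Walk (flip m) Z' k := by
        obtain ⟨r, h1, h2⟩ := walk_append.1 wZ
        rwa [← w₁.end_unique h1] at h2
      have sep₁ : ∀ v ∈ l₁.map G.endpt, v ∈ (Z' ++ (l ++ R)).map G.endpt → v = m.1 := by
        refine fun v h1 h2 => hW.eq_of_common (map_fst_perm_iff.2 fun x => ?_) w₁
          (wZ'.append (wl.append wR)) h1 h2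
        simp only [List.append_assoc]
      refine Bidirection.Bicircuit.mem_circuitCone ⟨wl, wR, w₁, nl, hn, n₁, ?_, ?_, ?_⟩
      · intro v h1 h2
        refine ⟨sep_l v h1 ?_, sep₁ v h2 ?_⟩
        · simp only [List.map_append, List.mem_append]; tauto
        · simp only [List.map_append, List.mem_append]; tauto
      · intro v h1 h2
        refine sep_l v h1 ?_
        simp only [List.map_append, List.mem_append]; tauto
      · intro v h1 h2
        refine sep₁ v h1 ?_
        simp only [List.map_append, List.mem_append]; tauto
  · obtain ⟨X, l', Y, c, c', rfl, wX, wl', wY, hc, hl', n'⟩ := wR.exists_first_circuit hn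
    -- By irreducibility, the circuit `l'` is unbalanced.
    obtain rfl : c' = flip c := by
      rcases eq_or_eq_flip hc with rfl | h
      · refine absurd (map_fst_perm_iff.2 fun x => ?_)
          (hW l' (Y ++ (Z ++ (l ++ X))) _ _ wl' (wY.append (wZ.append (wl.append wX))) hl'
            (by simp [wl.ne_nil]))
        simp only [List.map_append, List.count_append]
        omega
      · exact h
    have nl' : (l'.map G.endpt).Nodup := by
      rw [List.map_append] at n'
      exact (List.nodup_append.1 n').2.1
    have sep' : ∀ v ∈ l'.map G.endpt, v ∈ (Y ++ (Z ++ (l ++ X))).map G.endpt → v = c.1 := by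
      refine fun v h1 h2 => hW.eq_of_common (map_fst_perm_iff.2 fun x => ?_) wl'
        (wY.append (wZ.append (wl.append wX))) h1 h2
      simp only [List.map_append, List.count_append]
      omega
    have dis : ∀ v ∈ X.map G.endpt, v ∉ l'.map G.endpt := by
      rw [List.map_append] at n'
      exact fun v h1 h2 => List.disjoint_of_nodup_append n' h1 h2
    have hB : τ.Bicircuit k c l X l' := by
      refine ⟨wl, wX, wl', nl, ?_, nl', ?_, ?_, ?_⟩
      · rw [List.map_append] at n'
        refine List.nodup_middle.2 ?_
        rw [List.append_nil, List.nodup_cons]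
        exact ⟨fun h => dis _ h (wl'.fst_mem hl'), (List.nodup_append.1 n').1⟩
      · intro v h1 h2
        refine ⟨sep_l v h1 ?_, sep' v h2 ?_⟩
        · simp only [List.map_append, List.mem_append]; tauto
        · simp only [List.map_append, List.mem_append]; tauto
      · intro v h1 h2
        refine sep_l v h1 ?_
        simp only [List.map_append, List.mem_append]; tauto
      · intro v h1 h2
        exact absurd h1 (dis v h2)
    have hY : Y.length < N := by
      have := List.length_pos_iff.2 hl'
      simp only [List.length_append] at hlen
      omega
    have hrec := ih Y.length hY (Z := Z ++ (l ++ X)) (l := l') (R := Y) (k := c)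
      (by simp only [List.append_assoc]) (wZ.append (wl.append wX)) wl' wY nl'
      (by
        rcases hZ with ⟨rfl, rfl⟩ | ⟨Z', rfl⟩
        · exact Or.inr ⟨X, rfl⟩
        · exact Or.inr ⟨Z' ++ (l ++ X), by simp only [List.append_assoc]⟩) rfl
    have sum := τ.circuitCone.add_mem hB.mem_circuitCone hrec
    convert sum using 1
    rw [edgeCount_append, edgeCount_append]
    module

/-- The edges of a closed consistent walk, counted with multiplicities, form a sum of characteristic
flows of consistently directed signed circuits. -/
theorem Bidirection.Walk.edgeCount_mem {p : V × Bool} {W : List (E × Bool)} (w : τ.Walk p W p) :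
    edgeCount W ∈ τ.circuitCone := by
  induction hN : W.length using Nat.strong_induction_on generalizing W p with
  | _ N ih =>
  by_cases h0 : W = []
  · rw [h0, edgeCount_nil]
    exact τ.circuitCone.zero_mem
  by_cases hW : τ.Irreducible W
  · have hn : ¬ (W.map G.endpt ++ [p.1]).Nodup := by
      intro hn
      simpa using List.disjoint_of_nodup_append hn (w.fst_mem h0)
    obtain ⟨X, l, Y, m, m', rfl, wX, wl, wY, hm, hl, hn'⟩ := w.exists_first_circuit hn
    have nl : (l.map G.endpt).Nodup := by
      rw [List.map_append] at hn'
      exact (List.nodup_append.1 hn').2.1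
    have hperm : ((l ++ (Y ++ X)).map Prod.fst).Perm ((X ++ (l ++ Y)).map Prod.fst) := by
      refine map_fst_perm_iff.2 fun x => ?_
      simp only [List.map_append, List.count_append]
      omega
    rw [← edgeCount_congr hperm]
    rcases eq_or_eq_flip hm with rfl | rfl
    · by_cases hYX : Y ++ X = []
      · rw [hYX, List.append_nil]
        exact wl.edgeCount_mem_of_nodup hl nl
      · exact absurd hperm (hW l (Y ++ X) _ _ wl (wY.append wX) hl hYX)
    · have hW' : τ.Irreducible (l ++ (Y ++ X)) := fun a b c d ha hb na nb hab =>
        hW a b c d ha hb na nb (hab.trans hperm)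
      have := hW'.half_mem wl nl (Z := []) (R := Y ++ X) rfl rfl wl (wY.append wX) nl
        (Or.inl ⟨rfl, rfl⟩)
      convert this using 1
      rw [edgeCount_append]
      module
  · simp only [Bidirection.Irreducible, not_forall, not_not] at hW
    obtain ⟨a, b, c, d, ha, hb, na, nb, hab⟩ := hW
    rw [← edgeCount_congr hab, edgeCount_append]
    have hlen : a.length + b.length = W.length := by
      simpa using hab.length_eq
    have := List.length_pos_iff.2 na
    have := List.length_pos_iff.2 nb
    exact τ.circuitCone.add_mem (ih a.length (by omega) ha rfl) (ih b.length (by omega) hb rfl)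

/-! ### Flows contain closed consistent walks -/

/-- The contribution of a half-edge with `inward h = s` and value `1` to the excess at its vertex. -/
def incidence (s : Bool) : ℤ := if s then 1 else -1

theorem incidence_not (s : Bool) : incidence (!s) = -incidence s := by
  cases s <;> simp [incidence]

open Classical in
/-- The contribution of a half-edge with source state `p` and value `1` to the excess at `v`. -/
noncomputable def stateExcess (p : V × Bool) (v : V) : ℤ := if p.1 = v then incidence p.2 else 0

theorem stateExcess_flip (p : V × Bool) (v : V) : stateExcess (flip p) v = -stateExcess p v := by
  simp only [stateExcess, incidence_not]
  split_ifs <;> simp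

/-- The sum of the incoming values minus the sum of the outgoing values at `v`. -/
noncomputable def Bidirection.excess [Fintype E] (τ : G.Bidirection) (f : E → ℤ) (v : V) : ℤ :=
  ∑ h : E × Bool, stateExcess (τ.src h) v * f h.1

theorem isFlow_iff_excess [Fintype E] (τ : G.Bidirection) (f : E → ℤ) :
    G.IsFlow τ f ↔ ∀ v, τ.excess f v = 0 := by
  classical
  refine forall_congr' fun v => ?_
  rw [← sub_eq_zero, Finset.sum_filter, Finset.sum_filter, ← Finset.sum_sub_distrib,
    Bidirection.excess]
  refine iff_of_eq (congrArg (· = 0) (Finset.sum_congr rfl fun h _ => ?_))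
  by_cases hv : G.endpt h = v <;> cases hi : τ.inward h <;>
    simp [stateExcess, Bidirection.src, incidence, hv, hi]

theorem excess_add [Fintype E] (f g : E → ℤ) (v : V) :
    τ.excess (f + g) v = τ.excess f v + τ.excess g v := by
  simp [Bidirection.excess, mul_add, Finset.sum_add_distrib]

theorem excess_sub [Fintype E] (f g : E → ℤ) (v : V) :
    τ.excess (f - g) v = τ.excess f v - τ.excess g v := by
  simp [Bidirection.excess, mul_sub, Finset.sum_sub_distrib]

open Classical in
/-- One unit of flow on the edge of `h`. -/
noncomputable def unit (h : E × Bool) : E → ℤ := Pi.single h.1 1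

/-- Traversing an edge from one state to another moves one unit of excess between them. -/
theorem excess_unit [Fintype E] (h : E × Bool) (v : V) :
    τ.excess (unit h) v = stateExcess (τ.src h) v - stateExcess (τ.tgt h) v := by
  classical
  rw [Bidirection.tgt, stateExcess_flip, sub_neg_eq_add, Bidirection.excess,
    Fintype.sum_prod_type, Fintype.sum_eq_single h.1]
  · obtain ⟨e, b⟩ := h
    cases b <;> simp [unit, opp, add_comm]
  · intro e he
    simp [unit, he]

open Classical in
/-- The number of traversals of each edge by a walk, as an integer vector. -/
noncomputable def traversals (l : List (E × Bool)) (e : E) : ℤ := ((l.map Prod.fst).count e : ℤ)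

theorem edgeCount_eq_traversals (l : List (E × Bool)) (e : E) :
    edgeCount l e = (traversals l e : ℚ) := by
  simp [edgeCount, traversals]

theorem traversals_nil : traversals ([] : List (E × Bool)) = 0 := by
  funext e
  simp [traversals]

theorem traversals_cons (h : E × Bool) (l : List (E × Bool)) :
    traversals (h :: l) = unit h + traversals l := by
  classical
  funext e
  rw [traversals, List.map_cons, List.count_cons]
  by_cases he : h.1 = e
  · subst he
    simp [traversals, unit, add_comm]
  · simp [traversals, unit, he, Ne.symm he]

theorem traversals_nonneg (l : List (E × Bool)) : 0 ≤ traversals l :=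
  fun _ => Int.natCast_nonneg _

theorem unit_le {r : E → ℤ} (hr : 0 ≤ r) {h : E × Bool} (hpos : 0 < r h.1) : unit h ≤ r := by
  classical
  intro e
  by_cases he : e = h.1
  · subst he
    simpa [unit] using Int.add_one_le_of_lt hpos
  · simpa [unit, he] using hr e

theorem sum_unit [Fintype E] (h : E × Bool) : ∑ e, unit h e = 1 := by
  classical
  simp [unit]

theorem Bidirection.Walk.excess_traversals [Fintype E] {p q : V × Bool} {l : List (E × Bool)}
    (w : τ.Walk p l q) (v : V) :
    τ.excess (traversals l) v = stateExcess p v - stateExcess q v := by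
  induction l generalizing p with
  | nil =>
    obtain rfl : p = q := w
    simp [traversals_nil, Bidirection.excess]
  | cons h l ih =>
    obtain ⟨rfl, w⟩ := w
    rw [traversals_cons, excess_add, excess_unit, ih w]
    ring

/-- A walk that has left the state `p`, and has arrived in another state `q`, can be continued along an
edge with a positive residual value. -/
theorem exists_continuation [Fintype E] {r : E → ℤ} (hr : 0 ≤ r) {p q : V × Bool} (hpq : q ≠ p)
    (hex : ∀ v, τ.excess r v = stateExcess q v - stateExcess p v) :
    ∃ h : E × Bool, τ.src h = q ∧ 0 < r h.1 := by
  classical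
  have hpos : 0 < incidence q.2 * τ.excess r q.1 := by
    rw [hex q.1]
    by_cases hv : p.1 = q.1
    · obtain rfl : p = flip q := (eq_or_eq_flip hv.symm).resolve_left hpq.symm
      rw [stateExcess_flip]
      rcases q with ⟨v, _ | _⟩ <;> simp [stateExcess, incidence]
    · rcases q with ⟨v, _ | _⟩ <;> simp_all [stateExcess, incidence]
  rw [Bidirection.excess, Finset.mul_sum] at hpos
  obtain ⟨h, -, hh⟩ := Finset.exists_lt_of_sum_lt (f := fun _ : E × Bool => (0 : ℤ))
    (by simpa using hpos)
  have hv : G.endpt h = q.1 := by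
    by_contra hv
    simp [stateExcess, Bidirection.src, hv] at hh
  have h0 : 0 ≤ r h.1 := hr h.1
  -- The term of `h` is positive; it would not be if `h` had the source state `flip q`.
  rcases eq_or_eq_flip (p := q) (q := τ.src h) hv.symm with e | e
  · refine ⟨h, e, lt_of_le_of_ne h0 fun h' => ?_⟩
    simp [← h'] at hh
  · rw [e, stateExcess_flip] at hh
    rcases q with ⟨v, _ | _⟩ <;> simp [stateExcess, incidence] at hh <;> omega

/-- Continuing greedily, and reducing the residual values along the walk, finally leads back
to `p`. -/
theorem exists_walk_of_excess [Fintype E] {p q : V × Bool} {r : E → ℤ} (hr : 0 ≤ r)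
    (hex : ∀ v, τ.excess r v = stateExcess q v - stateExcess p v) :
    ∃ l, τ.Walk q l p ∧ traversals l ≤ r := by
  induction hN : (∑ e, r e).toNat using Nat.strong_induction_on generalizing q r with
  | _ N ih =>
  by_cases hpq : q = p
  · exact ⟨[], hpq, by rwa [traversals_nil]⟩
  obtain ⟨h, rfl, hpos⟩ := exists_continuation hr hpq hex
  have hle := unit_le hr hpos
  have hlt : (∑ e, (r - unit h) e).toNat < N := by
    have h1 : 1 ≤ ∑ e, r e := by
      rw [← sum_unit h]
      exact Finset.sum_le_sum fun e _ => hle e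
    simp only [Pi.sub_apply, Finset.sum_sub_distrib, sum_unit]
    omega
  obtain ⟨l, w, hl⟩ := ih _ hlt (q := τ.tgt h) (r := r - unit h) (sub_nonneg.2 hle)
    (fun v => by rw [excess_sub, hex, excess_unit]; ring) rfl
  refine ⟨h :: l, ⟨rfl, w⟩, ?_⟩
  rw [traversals_cons]
  exact le_sub_iff_add_le'.1 hl

/-- A non-negative integer flow is a sum of traversal vectors of closed consistent walks, and hence a
sum of characteristic flows. -/
theorem flow_mem_circuitCone [Fintype E] {f : E → ℤ} (hf : 0 ≤ f)
    (hex : ∀ v, τ.excess f v = 0) : (fun e => (f e : ℚ)) ∈ τ.circuitCone := by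
  induction hN : (∑ e, f e).toNat using Nat.strong_induction_on generalizing f with
  | _ N ih =>
  by_cases h0 : f = 0
  · subst h0
    convert τ.circuitCone.zero_mem using 1
    funext e
    simp
  obtain ⟨e, he⟩ : ∃ e, f e ≠ 0 := by
    by_contra! h
    exact h0 (funext h)
  let h : E × Bool := (e, false)
  have hle : unit h ≤ f := unit_le hf (lt_of_le_of_ne (hf e) he.symm)
  obtain ⟨l, w, hl⟩ := exists_walk_of_excess (τ := τ) (p := τ.src h) (q := τ.tgt h)
    (r := f - unit h) (sub_nonneg.2 hle)
    (fun v => by rw [excess_sub, hex, excess_unit]; ring)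
  have wc : τ.Walk (τ.src h) (h :: l) (τ.src h) := ⟨rfl, w⟩
  have hc : traversals (h :: l) ≤ f := by
    rw [traversals_cons]
    exact le_sub_iff_add_le'.1 hl
  have hlt : (∑ e, (f - traversals (h :: l)) e).toNat < N := by
    have h1 : 1 ≤ ∑ e, traversals (h :: l) e := by
      rw [← sum_unit h, traversals_cons]
      exact Finset.sum_le_sum fun e _ => le_add_of_nonneg_right (traversals_nonneg l e)
    have h2 : ∑ e, traversals (h :: l) e ≤ ∑ e, f e := Finset.sum_le_sum fun e _ => hc e
    simp only [Pi.sub_apply, Finset.sum_sub_distrib]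
    omega
  have hrest := ih _ hlt (f := f - traversals (h :: l)) (sub_nonneg.2 hc)
    (fun v => by rw [excess_sub, hex, wc.excess_traversals]; ring) rfl
  convert τ.circuitCone.add_mem hrest wc.edgeCount_mem using 1
  funext e
  simp [edgeCount_eq_traversals]

/-! ### Positive orientations -/

theorem excess_reexpress [Fintype E] (τ τ' : G.Bidirection) (φ : E → ℤ) (v : V) :
    τ'.excess (reexpress τ τ' φ) v = τ.excess φ v := by
  refine Finset.sum_congr rfl fun h _ => ?_
  obtain ⟨e, b⟩ := h
  by_cases hs : ∀ b, τ.inward (e, b) = τ'.inward (e, b)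
  · simp [reexpress, hs, Bidirection.src]
  · -- If two orientations differ at one half-edge of `e`, then they also differ at the other one.
    have hb : τ'.src (e, b) = flip (τ.src (e, b)) := by
      have hc := (τ.compat e).symm.trans (τ'.compat e)
      rw [Bool.forall_bool] at hs
      have key : ∀ x y x' y' : Bool, (x ≠ y ↔ x' ≠ y') → ¬ (x = x' ∧ y = y') →
          x' = !x ∧ y' = !y := by decide
      obtain ⟨h0, h1⟩ := key _ _ _ _ hc hs
      cases b
      · exact Prod.ext rfl h0
      · exact Prod.ext rfl h1
    simp only [reexpress, hs, if_false, hb, stateExcess_flip]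
    ring

theorem exists_isPositive (τ : G.Bidirection) (φ : E → ℤ) :
    ∃ τ' : G.Bidirection, IsPositive τ τ' φ := by
  refine ⟨⟨fun h => if φ h.1 < 0 then !τ.inward h else τ.inward h, fun e => ?_⟩, fun e => ?_⟩
  · rw [τ.compat e]
    split_ifs <;> simp
  · by_cases h : φ e < 0
    · simp only [reexpress, h, if_true, Bool.eq_not_self, forall_const, if_false]
      omega
    · simp only [reexpress, h, if_false, implies_true, if_true]
      omega

theorem exists_finset_of_mem_circuitCone {g : E → ℚ} (hg : g ∈ τ.circuitCone) :
    ∃ (𝒞 : Finset (Set E)) (n : Set E → ℕ),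
      (∀ C ∈ 𝒞, G.IsSignedCircuit C ∧ G.IsConsistentlyDirected τ C ∧ 0 < n C) ∧
      ∀ e, g e = ∑ C ∈ 𝒞, (n C : ℚ) * G.charFlow C e := by
  classical
  suffices h : ∃ c : Set E →₀ ℕ,
      (∀ C ∈ c.support, G.IsSignedCircuit C ∧ G.IsConsistentlyDirected τ C) ∧
      ∀ e, g e = c.sum fun C k => (k : ℚ) * G.charFlow C e by
    obtain ⟨c, h1, h2⟩ := h
    exact ⟨c.support, c, fun C hC => ⟨(h1 C hC).1, (h1 C hC).2,
      Nat.pos_of_ne_zero (Finsupp.mem_support_iff.1 hC)⟩, h2⟩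
  induction hg using AddSubmonoid.closure_induction with
  | mem x hx =>
    obtain ⟨C, hC, rfl⟩ := hx
    refine ⟨Finsupp.single C 1, fun D hD => ?_, fun e => ?_⟩
    · obtain rfl : D = C := by simpa using Finsupp.support_single_subset hD
      exact hC
    · rw [Finsupp.sum_single_index] <;> simp
  | zero => exact ⟨0, by simp, by simp⟩
  | add x y _ _ hx hy =>
    obtain ⟨c, h1, h2⟩ := hx
    obtain ⟨d, h3, h4⟩ := hy
    refine ⟨c + d, fun C hC => ?_, fun e => ?_⟩
    · rcases Finset.mem_union.1 (Finsupp.support_add hC) with h | h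
      · exact h1 C h
      · exact h3 C h
    · rw [Finsupp.sum_add_index' (by simp) (by intros; push_cast; ring), Pi.add_apply, h2, h4]

end SignedGraph

theorem theorem2 {V E : Type*} [Fintype E] (G : SignedGraph V E) (τ : G.Bidirection)
    (φ : E → ℤ) (hφ : G.IsFlow τ φ) :
    (∃ τ' : G.Bidirection, SignedGraph.IsPositive τ τ' φ) ∧
    ∀ τ' : G.Bidirection, SignedGraph.IsPositive τ τ' φ →
      ∃ (𝒞 : Finset (Set E)) (n : Set E → ℕ),
        (∀ C ∈ 𝒞, G.IsSignedCircuit C ∧ G.IsConsistentlyDirected τ' C ∧ 0 < n C) ∧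
        ∀ e, (SignedGraph.reexpress τ τ' φ e : ℚ) = ∑ C ∈ 𝒞, (n C : ℚ) * G.charFlow C e := by
  refine ⟨SignedGraph.exists_isPositive τ φ, fun τ' hτ' => ?_⟩
  refine SignedGraph.exists_finset_of_mem_circuitCone
    (SignedGraph.flow_mem_circuitCone (τ := τ') hτ' fun v => ?_)
  rw [SignedGraph.excess_reexpress]
  exact (SignedGraph.isFlow_iff_excess τ φ).1 hφ v
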